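/- Let $1\le N_r\le N$ and $\Delta\ge 1$ be integers, $K=\Delta N$, $M=\Delta(N-N_r+1)$, and let $W_1,\dots,W_K$ be i.i.d. $\mathrm{Bern}(\epsilon)$ variables with values in $\mathbb{F}_2$, $\epsilon\in(0,1)$. Under cyclic placement, server $i\in[N]$ stores $X_i=W_{\mathcal Z_i}$, where $\mathcal Z_i=\bigcup_{r=0}^{\Delta-1}\{\,((i+j-1)\bmod N)+1+rN : 0\le j\le N-N_r\,\}$, so that $|\mathcal Z_i|=M$. The user demands $n$ independent repetitions of the multilinear function $f(W_1,\dots,W_K)=\prod_{k=1}^K W_k$. A *sequential characteristic graph-based scheme* of blocklength $n$ consists of distinct servers $i_1,\dots,i_L$ that transmit in this order. Server $i_l$ sees its own sequence $\mathbf X_{i_l}$ and the earlier transmissions $\mathbf Z_{i_1},\dots,\mathbf Z_{i_{l-1}}$, and sends a color $\mathbf Z_{i_l}=g_l(\mathbf Z_{i_1},\dots,\mathbf Z_{i_{l-1}},\mathbf X_{i_l})$. For each value of the earlier transmissions, $g_l$ must be a valid coloring of the following graph: two sequences $\mathbf x,\mathbf x'$ of server $i_l$ are adjacent if they have a common completion,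 by values of the subfunctions not stored at $i_l$, which in both cases has positive probability and agrees with the earlier transmissions, and for which the two sequences of values of $f$ differ (without earlier transmissions, this is the $n$-th OR power of the characteristic graph of the server). The user must recover the $n$ values of $f$ from $\mathbf Z_{i_1},\dots,\mathbf Z_{i_L}$ without error. The rate of server $i_l$ is $R_{i_l}=\frac1n H(\mathbf Z_{i_l})$, in bits. A number $R$ is an achievable sum rate if for each $\delta>0$ and all sufficiently large $n$ there is such a scheme with $\sum_l R_{i_l}\le R+\delta$. Let $R_{\rm ach}$ be the infimum of the achievable sum rates. Write $h$ for the binary entropy function (in bits), $\epsilon_m=\epsilon^m$, $N^*=\lfloor N/(N-N_r+1)\rfloor$, $\Delta_N=N-N^*(N-N_r+1)$ and $\xi_N=\Delta\cdot\Delta_N$. Then $$\frac{1-(\epsilon_M)^{N^*}}{1-\epsilon_M}\,h(\epsilon_M)+(\epsilon_M)^{N^*}\,1_{\Delta_N>0}\,h(\epsilon_{\xi_N})$$ is an achievable sum rate; in particular, $R_{\rm ach}$ is at most this number. -/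

import Mathlib

/-- The values `(w_k)_k` of the `K` binary subfunctions at one time instant. -/
abbrev Data (K : ℕ) : Type := Fin K → ZMod 2

/-- A length-`n` sequence of subfunction values. -/
abbrev Block (K n : ℕ) : Type := Fin n → Data K

/-- The length-`n` sequences that can be seen by a server storing the indices in `A`. -/
abbrev LocalBlock {K : ℕ} (A : Finset (Fin K)) (n : ℕ) : Type := Fin n → A → ZMod 2

/-- What a server storing the indices in `A` sees of the data sequence `w`. -/
def localView {K n : ℕ} (A : Finset (Fin K)) (w : Block K n) : LocalBlock A n :=
  fun t k => w t k

/-- Cyclic placement (indices start at `0`): server `i` stores the indices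
`((i + j) mod N) + r N` for `0 ≤ r < Δ` and `0 ≤ j ≤ N - Nr`. -/
def cyclicPlacement (N Nr Δ K : ℕ) (i : Fin N) : Finset (Fin K) :=
  Finset.univ.filter fun k => (k : ℕ) ∈ (Finset.range Δ).biUnion fun r =>
    (Finset.range (N - Nr + 1)).image fun j => ((i : ℕ) + j) % N + r * N

/-- The multilinear demand `∏ k, W_k` over the field with two elements. -/
def multilinearDemand (K : ℕ) (w : Data K) : ZMod 2 := ∏ k, w k

/-- The law of `K` i.i.d. `Bern(ε)` subfunctions, as a probability mass function. -/
noncomputable def bernLaw (K : ℕ) (ε : ℝ) (w : Data K) : ℝ :=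
  ∏ k, if w k = 1 then ε else 1 - ε

/-- The law of `n` independent repetitions of `p`. -/
noncomputable def blockLaw {K : ℕ} (p : Data K → ℝ) (n : ℕ) (w : Block K n) : ℝ :=
  ∏ t, p (w t)

/-- Shannon entropy, in bits, of the random variable `g` when the sample has mass function `P`. -/
noncomputable def entropyBits {α β : Type} [Fintype α] [DecidableEq β] (P : α → ℝ) (g : α → β) :
    ℝ :=
  ∑ b ∈ Finset.univ.image g,
    Real.negMulLog (∑ a ∈ Finset.univ.filter (fun a => g a = b), P a) / Real.log 2

/-- The binary entropy function, in bits. -/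
noncomputable def binEntropyBits (q : ℝ) : ℝ := Real.binEntropy q / Real.log 2

/-- The characteristic graph, for computing `f` at all `n` time instants, of a server that stores
the indices in `A` and knows that the data sequence lies in `C`. Two local sequences are adjacent
when they have a common completion by values of the other indices, of positive probability and
compatible with `C` in both cases, for which the two function sequences differ (in at least one
coordinate). When `C` is everything and `p` has full support, this is the `n`-th OR power of the
single-letter characteristic graph. -/
def condCharGraph {K n : ℕ} (p : Data K → ℝ) (f : Data K → ZMod 2) (A : Finset (Fin K))
    (C : Set (Block K n)) : SimpleGraph (LocalBlock A n) where
  Adj x x' := ∃ w ∈ C, ∃ w' ∈ C,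
    localView A w = x ∧ localView A w' = x' ∧
    0 < blockLaw p n w ∧ 0 < blockLaw p n w' ∧
    (∀ t, ∀ k ∉ A, w t k = w' t k) ∧ ∃ t, f (w t) ≠ f (w' t)
  symm := ⟨by
    rintro x x' ⟨w, hw, w', hw', h1, h2, h3, h4, h5, t, h6⟩
    exact ⟨w', hw', w, hw, h2, h1, h4, h3, fun t k hk => (h5 t k hk).symm, t, h6.symm⟩⟩
  loopless := ⟨by
    rintro x ⟨w, hw, w', hw', h1, h2, h3, h4, h5, t, h6⟩
    apply h6
    congr 1
    funext k
    by_cases hk : k ∈ A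
    · exact congrFun (congrFun (h1.trans h2.symm) t) ⟨k, hk⟩
    · exact h5 t k hk⟩

/-- A sequential transmission scheme of blocklength `n` for the placement `Z`: distinct servers
`server 0, server 1, …` transmit one after the other, and each of them maps the earlier
transmissions and its own local sequence to a color. -/
structure SeqScheme {N K : ℕ} (Z : Fin N → Finset (Fin K)) (n : ℕ) where
  /-- the number of transmitting servers -/
  len : ℕ
  /-- the order in which they transmit -/
  server : Fin len → Fin N
  server_injective : Function.Injective server
  /-- the encoding functions -/
  encode : (l : Fin len) → (Fin l → ℕ) → LocalBlock (Z (server l)) n → ℕ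
  /-- the color transmitted in step `l` on the data sequence `w` -/
  transmit : Fin len → Block K n → ℕ
  transmit_eq : ∀ (l : Fin len) (w : Block K n),
    transmit l w =
      encode l (fun j => transmit (Fin.castLE l.isLt.le j) w) (localView (Z (server l)) w)

namespace SeqScheme

variable {N K n : ℕ} {Z : Fin N → Finset (Fin K)}

/-- The data sequences that produce the transmissions `z` in the steps before step `l`. -/
def compatible (c : SeqScheme Z n) (l : Fin c.len) (z : Fin l → ℕ) : Set (Block K n) :=
  {w | ∀ j : Fin l, c.transmit (Fin.castLE l.isLt.le j) w = z j}

/-- In every step, and for all earlier transmissions, the encoding function is a valid coloring of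
the characteristic graph that the server builds given these earlier transmissions. -/
def IsColoring (c : SeqScheme Z n) (p : Data K → ℝ) (f : Data K → ZMod 2) : Prop :=
  ∀ (l : Fin c.len) (z : Fin l → ℕ) (x x' : LocalBlock (Z (c.server l)) n),
    (condCharGraph p f (Z (c.server l)) (c.compatible l z)).Adj x x' →
      c.encode l z x ≠ c.encode l z x'

/-- The user recovers the function sequence from the transmissions, without loss. -/
def IsLossless (c : SeqScheme Z n) (p : Data K → ℝ) (f : Data K → ZMod 2) : Prop :=
  ∃ dec : (Fin c.len → ℕ) → (Fin n → ZMod 2),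
    ∀ w : Block K n, 0 < blockLaw p n w →
      dec (fun l => c.transmit l w) = fun t => f (w t)

/-- The sum over the servers of their rates; the rate of a server is the entropy of its
transmission divided by the blocklength. -/
noncomputable def sumRate (c : SeqScheme Z n) (p : Data K → ℝ) : ℝ :=
  ∑ l : Fin c.len, entropyBits (blockLaw p n) (c.transmit l) / n

end SeqScheme

/-- `R` is an achievable sum rate of sequential characteristic graph-based compression. -/
def IsAchievableSumRate {N K : ℕ} (Z : Fin N → Finset (Fin K)) (p : Data K → ℝ)
    (f : Data K → ZMod 2) (R : ℝ) : Prop :=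
  ∀ δ > 0, ∃ n₀ : ℕ, ∀ n ≥ n₀, ∃ c : SeqScheme Z n,
    c.IsColoring p f ∧ c.IsLossless p f ∧ c.sumRate p ≤ R + δ

/-- The optimal achievable sum rate. -/
noncomputable def achievableSumRate {N K : ℕ} (Z : Fin N → Finset (Fin K)) (p : Data K → ℝ)
    (f : Data K → ZMod 2) : ℝ :=
  sInf {R : ℝ | IsAchievableSumRate Z p f R}

/-! The product is 1 only if every subfunction is 1, so a server need only refine what is still
undecided. Put `m = N - Nr + 1`: the servers `0, m, 2m, …` hold consecutive windows of residues
modulo `N`, and `C l` collects the indices in the first `l` windows. Server `l` speaks only about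
the times at which `C l` is all ones, with one bit per time: is `C (l + 1)` all ones too? Earlier
messages determine those times, so the bits are computable, and after the last window they reveal
the product.

Per symbol a time is active with probability `ε ^ |C l|`, and its bit is Bernoulli with parameter `ε
^ (|C (l + 1)| - |C l|)`. Gibbs' inequality (`entropyBits_le_cross`) bounds the entropy of this
string of random length by the corresponding ideal code length plus `log (n + 1)`, which vanishes
after division by `n`. Full windows give the geometric sum; a partial last window gives the
indicator term. -/

/-! ### Active times and the chain scheme -/

/-- All the entries of `v` with index in `C` are equal to `1`. -/
abbrev OnesOn {K : ℕ} (C : Finset (Fin K)) (v : Data K) : Prop := ∀ k ∈ C, v k = 1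

/-- The times at which all the subfunctions with index in `C` are equal to `1`. -/
def activeTimes {K n : ℕ} (C : Finset (Fin K)) (w : Block K n) : List (Fin n) :=
  (List.finRange n).filter fun t => OnesOn C (w t)

/-- Among the active times of `C`, the bits that tell which ones are active for `D`. -/
def refineBits {K n : ℕ} (C D : Finset (Fin K)) (w : Block K n) : List Bool :=
  (activeTimes C w).map fun t => decide (OnesOn D (w t))

theorem mem_activeTimes {K n : ℕ} {C : Finset (Fin K)} {w : Block K n} {t : Fin n} :
    t ∈ activeTimes C w ↔ OnesOn C (w t) := by
  simp [activeTimes]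

theorem activeTimes_congr {K n : ℕ} {C : Finset (Fin K)} {w w' : Block K n}
    (h : ∀ t, OnesOn C (w t) ↔ OnesOn C (w' t)) : activeTimes C w = activeTimes C w' := by
  unfold activeTimes
  exact List.filter_congr fun t _ => by simpa using h t

theorem onesOn_iff_of_refineBits_eq {K n : ℕ} {C D : Finset (Fin K)} (hCD : C ⊆ D)
    {w w' : Block K n} (h : ∀ t, OnesOn C (w t) ↔ OnesOn C (w' t))
    (hb : refineBits C D w = refineBits C D w') (t : Fin n) :
    OnesOn D (w t) ↔ OnesOn D (w' t) := by
  unfold refineBits at hb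
  rw [activeTimes_congr h, List.map_inj_left] at hb
  by_cases ht : OnesOn C (w' t)
  · exact decide_eq_decide.mp (hb t (mem_activeTimes.mpr ht))
  · exact iff_of_false (fun hD => ht ((h t).mp fun k hk => hD k (hCD hk)))
      fun hD => ht fun k hk => hD k (hCD hk)

/-- By induction, the active times of one step and the bits sent there fix the active times of the
next. Encoding, coloring and decoding all rest on this. -/
theorem onesOn_iff_of_forall_refineBits_eq {K n : ℕ} {C : ℕ → Finset (Fin K)} (h0 : C 0 = ∅)
    (hC : Monotone C) {w w' : Block K n} (l : ℕ)
    (h : ∀ j < l, refineBits (C j) (C (j + 1)) w = refineBits (C j) (C (j + 1)) w') (t : Fin n) :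
    OnesOn (C l) (w t) ↔ OnesOn (C l) (w' t) := by
  induction l generalizing t with
  | zero => simp [h0, OnesOn]
  | succ l ih =>
    exact onesOn_iff_of_refineBits_eq (hC l.le_succ) (ih fun j hj => h j (hj.trans l.lt_succ_self))
      (h l l.lt_succ_self) t

theorem multilinearDemand_eq_ite {K : ℕ} (v : Data K) :
    multilinearDemand K v = if OnesOn Finset.univ v then 1 else 0 := by
  unfold multilinearDemand
  split_ifs with h
  · exact Finset.prod_eq_one h
  · simp only [OnesOn, not_forall] at h
    obtain ⟨k, hk, hv⟩ := h
    have h2 : ∀ x : ZMod 2, x ≠ 1 → x = 0 := by decide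
    exact Finset.prod_eq_zero hk (h2 _ hv)

open Classical in
/-- The scheme in which server `l` reports, at the active times of `C l`, the bits that tell which
of them are active for `C (l + 1)`. -/
noncomputable def chainScheme {N K : ℕ} (Z : Fin N → Finset (Fin K)) (C : ℕ → Finset (Fin K))
    (h0 : C 0 = ∅) (hC : Monotone C) (L : ℕ) (server : Fin L → Fin N)
    (hs : Function.Injective server) (hZ : ∀ l : Fin L, C (l + 1) \ C l ⊆ Z (server l)) (n : ℕ) :
    SeqScheme Z n where
  len := L
  server := server
  server_injective := hs
  encode l z x :=
    -- Any data sequence consistent with the received `z` has the true active times, so an arbitrary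
    -- choice serves. The value 0 is only for impossible `z`.
    if h : ∃ w : Block K n, ∀ j : Fin l,
        Encodable.encode (refineBits (C j) (C (j + 1)) w) = z j then
      Encodable.encode ((activeTimes (C l) h.choose).map fun t =>
        decide (∀ k : Z (server l), k.1 ∈ C (l + 1) → k.1 ∉ C l → x t k = 1))
    else 0
  transmit l w := Encodable.encode (refineBits (C l) (C (l + 1)) w)
  transmit_eq l w := by
    have h : ∃ w' : Block K n, ∀ j : Fin l,
        Encodable.encode (refineBits (C j) (C (j + 1)) w') =
          Encodable.encode (refineBits (C j) (C (j + 1)) w) := ⟨w, fun _ => rfl⟩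
    simp only [Fin.val_castLE]
    rw [dif_pos h]
    have hact : activeTimes (C l) h.choose = activeTimes (C l) w :=
      activeTimes_congr (onesOn_iff_of_forall_refineBits_eq h0 hC l fun j hj =>
        Encodable.encode_injective (h.choose_spec ⟨j, hj⟩))
    rw [hact, refineBits]
    congr 1
    refine List.map_congr_left fun t ht => decide_eq_decide.mpr ⟨fun hk k h1 _ => hk _ h1, ?_⟩
    intro hk k h1
    by_cases h2 : k ∈ C l
    · exact mem_activeTimes.mp ht k h2
    · exact hk ⟨k, hZ l (Finset.mem_sdiff.mpr ⟨h1, h2⟩)⟩ h1 h2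

section ChainScheme

variable {N K : ℕ} {Z : Fin N → Finset (Fin K)} {C : ℕ → Finset (Fin K)}
  {h0 : C 0 = ∅} {hC : Monotone C} {L : ℕ} {server : Fin L → Fin N}
  {hs : Function.Injective server} {hZ : ∀ l : Fin L, C (l + 1) \ C l ⊆ Z (server l)} {n : ℕ}

/-- Equal colors force the same active times for `C (l + 1)`. At such a time the server's whole view
is ones in both sequences, which then coincide; at any other time both products vanish. -/
theorem chainScheme_isColoring (p : Data K → ℝ) (hcov : ∀ l : Fin L, Z (server l) ⊆ C (l + 1)) :
    (chainScheme Z C h0 hC L server hs hZ n).IsColoring p (multilinearDemand K) := by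
  set c := chainScheme Z C h0 hC L server hs hZ n with hc
  intro l z x x' ⟨w, hw, w', hw', hx, hx', _, _, hout, t, hf⟩ heq
  have e : c.transmit l w = c.encode l z x := by
    rw [c.transmit_eq, hx, show (fun j => c.transmit (Fin.castLE l.isLt.le j) w) = z from
      funext hw]
  have e' : c.transmit l w' = c.encode l z x' := by
    rw [c.transmit_eq, hx', show (fun j => c.transmit (Fin.castLE l.isLt.le j) w') = z from
      funext hw']
  have hb : ∀ j < (l : ℕ) + 1,
      refineBits (C j) (C (j + 1)) w = refineBits (C j) (C (j + 1)) w' := by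
    intro j hj
    apply Encodable.encode_injective
    rcases Nat.lt_succ_iff_lt_or_eq.mp hj with hj | rfl
    · exact (hw ⟨j, hj⟩).trans (hw' ⟨j, hj⟩).symm
    · exact e.trans (heq.trans e'.symm)
  have hiff := onesOn_iff_of_forall_refineBits_eq h0 hC _ hb t
  apply hf
  by_cases h1 : OnesOn (C (l + 1)) (w t)
  · congr 1
    funext k
    by_cases hk : k ∈ Z (server l)
    · rw [h1 k (hcov l hk), hiff.mp h1 k (hcov l hk)]
    · exact hout t k hk
  · have h1' := fun h => h1 (hiff.mpr h)
    rw [multilinearDemand_eq_ite, multilinearDemand_eq_ite,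
      if_neg fun h => h1 fun k _ => h k (Finset.mem_univ k),
      if_neg fun h => h1' fun k _ => h k (Finset.mem_univ k)]

theorem chainScheme_isLossless (p : Data K → ℝ) (hL : C L = Finset.univ) :
    (chainScheme Z C h0 hC L server hs hZ n).IsLossless p (multilinearDemand K) := by
  classical
  set c := chainScheme Z C h0 hC L server hs hZ n with hc
  refine ⟨fun z => if h : ∃ w, (fun l => c.transmit l w) = z then
    fun t => multilinearDemand K (h.choose t) else 0, fun w _ => ?_⟩
  have h : ∃ w', (fun l => c.transmit l w') = fun l => c.transmit l w := ⟨w, rfl⟩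
  refine (dif_pos h).trans ?_
  funext t
  have := onesOn_iff_of_forall_refineBits_eq h0 hC L (w := h.choose) (w' := w) (fun j hj =>
    Encodable.encode_injective (congrFun h.choose_spec ⟨j, hj⟩)) t
  rw [hL] at this
  simp only [multilinearDemand_eq_ite, this]

end ChainScheme

/-! ### Entropy and code lengths -/

section Entropy

theorem entropyBits_comp_injective {α β γ : Type} [Fintype α] [DecidableEq β] [DecidableEq γ]
    (P : α → ℝ) (g : α → β) {φ : β → γ} (hφ : Function.Injective φ) :
    entropyBits P (fun a => φ (g a)) = entropyBits P g := by
  unfold entropyBits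
  rw [show Finset.univ.image (fun a => φ (g a)) = (Finset.univ.image g).image φ by
    rw [Finset.image_image]; rfl, Finset.sum_image fun _ _ _ _ h => hφ h]
  simp only [hφ.eq_iff]

theorem entropyBits_nonneg {α β : Type} [Fintype α] [DecidableEq β] {P : α → ℝ}
    (h0 : ∀ a, 0 ≤ P a) (h1 : ∑ a, P a = 1) (g : α → β) : 0 ≤ entropyBits P g := by
  refine Finset.sum_nonneg fun b _ => div_nonneg (Real.negMulLog_nonneg
    (Finset.sum_nonneg fun a _ => h0 a) ?_) (Real.log_nonneg one_le_two)
  rw [← h1]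
  exact Finset.sum_le_sum_of_subset_of_nonneg (Finset.subset_univ _) fun a _ _ => h0 a

theorem negMulLog_le_cross {p q : ℝ} (hp : 0 ≤ p) (hq : 0 < q) :
    Real.negMulLog p ≤ p * -Real.log q + (q - p) := by
  rcases hp.eq_or_lt with rfl | hp
  · simpa using hq.le
  · have h := Real.log_le_sub_one_of_pos (div_pos hq hp)
    rw [Real.log_div hq.ne' hp.ne'] at h
    have h2 := mul_le_mul_of_nonneg_left h hp.le
    have h3 : p * (q / p - 1) = q - p := by field_simp
    rw [Real.negMulLog]
    linarith

/-- Gibbs' inequality: the entropy is at most the expected length of an ideal code. -/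
theorem entropyBits_le_cross {α β : Type} [Fintype α] [DecidableEq β] {P : α → ℝ}
    (h0 : ∀ a, 0 ≤ P a) (h1 : ∑ a, P a = 1) (g : α → β) (q : β → ℝ) (hq : ∀ b, 0 < q b)
    (hq1 : ∑ b ∈ Finset.univ.image g, q b ≤ 1) :
    entropyBits P g ≤ (∑ a, P a * -Real.log (q (g a))) / Real.log 2 := by
  unfold entropyBits
  rw [← Finset.sum_div]
  refine div_le_div_of_nonneg_right ?_ (Real.log_nonneg one_le_two)
  have hfib : ∀ F : α → ℝ,
      ∑ b ∈ Finset.univ.image g, ∑ a ∈ Finset.univ.filter (fun a => g a = b), F a = ∑ a, F a :=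
    fun F => Finset.sum_fiberwise_of_maps_to
      (fun a _ => Finset.mem_image_of_mem g (Finset.mem_univ a)) F
  calc ∑ b ∈ Finset.univ.image g,
        Real.negMulLog (∑ a ∈ Finset.univ.filter (fun a => g a = b), P a)
      ≤ ∑ b ∈ Finset.univ.image g,
          ((∑ a ∈ Finset.univ.filter (fun a => g a = b), P a * -Real.log (q (g a)))
            + (q b - ∑ a ∈ Finset.univ.filter (fun a => g a = b), P a)) := by
        refine Finset.sum_le_sum fun b _ => ?_
        refine (negMulLog_le_cross (Finset.sum_nonneg fun a _ => h0 a) (hq b)).trans_eq ?_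
        rw [Finset.sum_mul]
        congr 1
        refine Finset.sum_congr rfl fun a ha => ?_
        rw [(Finset.mem_filter.mp ha).2]
    _ ≤ ∑ a, P a * -Real.log (q (g a)) := by
        -- The corrections `q - p` add up to at most `1 - 1 = 0`.
        rw [Finset.sum_add_distrib, Finset.sum_sub_distrib, hfib, hfib, h1]
        linarith

/-- The words of each fixed length `k` have total weight at most `(∑ r) ^ k = 1`, and there are `n +
1` possible lengths. -/
theorem sum_list_prod_le {β : Type} [Fintype β] [DecidableEq β] {r : β → ℝ} (hr : ∀ b, 0 ≤ r b)
    (hr1 : ∑ b, r b = 1) (n : ℕ) (F : Finset (List β)) (hF : ∀ s ∈ F, s.length ≤ n) :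
    ∑ s ∈ F, (s.map r).prod ≤ n + 1 := by
  have hnn : ∀ s : List β, 0 ≤ (s.map r).prod := fun s =>
    List.prod_nonneg fun x hx => by
      obtain ⟨b, _, rfl⟩ := List.mem_map.mp hx
      exact hr b
  have hk : ∀ k, ∑ s ∈ F.filter (fun s => s.length = k), (s.map r).prod ≤ 1 := by
    intro k
    have hsub : F.filter (fun s => s.length = k) ⊆
        (Finset.univ : Finset (Fin k → β)).image List.ofFn := by
      intro s hs
      obtain ⟨_, rfl⟩ := Finset.mem_filter.mp hs
      exact Finset.mem_image.mpr ⟨s.get, Finset.mem_univ _, List.ofFn_get s⟩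
    refine (Finset.sum_le_sum_of_subset_of_nonneg hsub fun s _ _ => hnn s).trans_eq ?_
    rw [Finset.sum_image fun _ _ _ _ h => List.ofFn_injective h]
    simp only [List.map_ofFn, List.prod_ofFn, Function.comp_apply]
    have := Finset.prod_univ_sum (fun _ : Fin k => (Finset.univ : Finset β)) fun _ b => r b
    rw [Fintype.piFinset_univ] at this
    rw [← this]
    simp [hr1]
  rw [← Finset.sum_fiberwise_of_maps_to (t := Finset.range (n + 1)) (g := List.length)
    fun s hs => Finset.mem_range_succ_iff.mpr (hF s hs)]
  refine (Finset.sum_le_sum fun k _ => hk k).trans_eq ?_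
  simp

end Entropy

/-! ### Expectations under the Bernoulli law -/

section Law

theorem sum_prod_apply {ι β : Type} [Fintype ι] [DecidableEq ι] [Fintype β] [DecidableEq β]
    (F : ι → β → ℝ) : ∑ w : ι → β, ∏ i, F i (w i) = ∏ i, ∑ b, F i b := by
  rw [Finset.prod_univ_sum, Fintype.piFinset_univ]

theorem bernLaw_nonneg {K : ℕ} {ε : ℝ} (h0 : 0 ≤ ε) (h1 : ε ≤ 1) (v : Data K) :
    0 ≤ bernLaw K ε v := by
  refine Finset.prod_nonneg fun k _ => ?_
  split_ifs
  · exact h0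
  · linarith

theorem sum_bernLaw_onesOn {K : ℕ} (ε : ℝ) (C : Finset (Fin K)) :
    ∑ v : Data K, bernLaw K ε v * (if OnesOn C v then 1 else 0) = ε ^ C.card := by
  have h : ∀ v : Data K, bernLaw K ε v * (if OnesOn C v then 1 else 0) =
      ∏ k, (if v k = 1 then ε else 1 - ε) * (if k ∈ C → v k = 1 then 1 else 0) := by
    intro v
    rw [Finset.prod_mul_distrib, Finset.prod_ite_zero]
    simp [bernLaw, OnesOn]
  have hs : ∀ F : ZMod 2 → ℝ, ∑ x, F x = F 0 + F 1 := fun F => Fin.sum_univ_two F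
  simp only [h]
  rw [sum_prod_apply (fun k (x : ZMod 2) =>
    (if x = 1 then ε else 1 - ε) * (if k ∈ C → x = 1 then 1 else 0))]
  have h2 : ∀ k, ∑ x : ZMod 2, (if x = 1 then ε else 1 - ε) * (if k ∈ C → x = 1 then 1 else 0)
      = if k ∈ C then ε else 1 := by
    intro k
    rw [hs]
    by_cases hk : k ∈ C <;> simp [hk]
  simp only [h2]
  rw [Finset.prod_ite_mem, Finset.univ_inter, Finset.prod_const]

theorem sum_bernLaw {K : ℕ} (ε : ℝ) : ∑ v : Data K, bernLaw K ε v = 1 := by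
  simpa [OnesOn] using sum_bernLaw_onesOn ε (∅ : Finset (Fin K))

theorem blockLaw_nonneg {K n : ℕ} {p : Data K → ℝ} (hp : ∀ v, 0 ≤ p v) (w : Block K n) :
    0 ≤ blockLaw p n w :=
  Finset.prod_nonneg fun _ _ => hp _

theorem sum_blockLaw {K : ℕ} {p : Data K → ℝ} (hp : ∑ v, p v = 1) (n : ℕ) :
    ∑ w : Block K n, blockLaw p n w = 1 := by
  unfold blockLaw
  rw [sum_prod_apply (fun _ v => p v)]
  simp [hp]

theorem sum_blockLaw_mul_apply {K n : ℕ} {p : Data K → ℝ} (hp : ∑ v, p v = 1) (φ : Data K → ℝ)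
    (t : Fin n) : ∑ w : Block K n, blockLaw p n w * φ (w t) = ∑ v, p v * φ v := by
  have h : ∀ w : Block K n, blockLaw p n w * φ (w t) =
      ∏ s, p (w s) * (if s = t then φ (w s) else 1) := by
    intro w
    rw [Finset.prod_mul_distrib, Finset.prod_ite_eq' Finset.univ t fun s => φ (w s)]
    simp [blockLaw]
  simp only [h]
  rw [sum_prod_apply (fun s v => p v * (if s = t then φ v else 1)),
    Finset.prod_eq_single t]
  · simp
  · intro s _ hs
    simp [hs, hp]
  · simp

end Law

/-- The ideal code for the bits sent at the active times has expected length per symbol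
`ε ^ |C| * h (ε ^ (|D| - |C|))`. -/
theorem sum_bernLaw_mul_codeLength {K : ℕ} (ε : ℝ) {C D : Finset (Fin K)} (hCD : C ⊆ D) :
    ∑ v : Data K, bernLaw K ε v * (if OnesOn C v then
        (if OnesOn D v then -Real.log (ε ^ (D.card - C.card))
          else -Real.log (1 - ε ^ (D.card - C.card))) else 0) =
      ε ^ C.card * Real.binEntropy (ε ^ (D.card - C.card)) := by
  set b := ε ^ (D.card - C.card) with hb
  have hD : ε ^ D.card = ε ^ C.card * b := by
    rw [hb, ← pow_add, Nat.add_sub_cancel' (Finset.card_le_card hCD)]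
  -- As `C ⊆ D`, the event "ones on `C` but not on `D`" has as indicator a difference of two
  -- indicators.
  have h : ∀ v : Data K, bernLaw K ε v * (if OnesOn C v then
        (if OnesOn D v then -Real.log b else -Real.log (1 - b)) else 0) =
      (bernLaw K ε v * (if OnesOn D v then 1 else 0)) * (-Real.log b + Real.log (1 - b))
      + (bernLaw K ε v * (if OnesOn C v then 1 else 0)) * (-Real.log (1 - b)) := by
    intro v
    by_cases hv : OnesOn D v
    · have hv' : OnesOn C v := fun k hk => hv k (hCD hk)
      rw [if_pos hv, if_pos hv', if_pos hv, if_pos hv']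
      ring
    · by_cases hv' : OnesOn C v
      · rw [if_neg hv, if_pos hv', if_neg hv, if_pos hv']
        ring
      · rw [if_neg hv', if_neg hv, if_neg hv']
        ring
  simp only [h]
  rw [Finset.sum_add_distrib, ← Finset.sum_mul, ← Finset.sum_mul, sum_bernLaw_onesOn,
    sum_bernLaw_onesOn, hD, Real.binEntropy, Real.log_inv, Real.log_inv]
  ring

/-- The reference weight of a word is its i.i.d. Bernoulli probability divided by `n + 1`, the price
of the unknown length. Strict inclusion keeps `1 - b` positive, hence every weight positive. -/
theorem entropyBits_refineBits_le {K : ℕ} {ε : ℝ} (hε0 : 0 < ε) (hε1 : ε < 1)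
    {C D : Finset (Fin K)} (hCD : C ⊂ D) (n : ℕ) :
    entropyBits (blockLaw (bernLaw K ε) n) (refineBits C D) ≤
      Real.log (n + 1) / Real.log 2
        + n * (ε ^ C.card * binEntropyBits (ε ^ (D.card - C.card))) := by
  set b := ε ^ (D.card - C.card) with hb
  have hb0 : 0 < b := pow_pos hε0 _
  have hb1 : b < 1 := pow_lt_one₀ hε0.le hε1 (Nat.sub_pos_of_lt (Finset.card_lt_card hCD)).ne'
  set r : Bool → ℝ := fun x => if x then b else 1 - b with hr
  have hr0 : ∀ x, 0 < r x := by
    intro x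
    cases x <;> simp [hr, hb0, hb1]
  have hn : (0 : ℝ) < n + 1 := by positivity
  have hprod : ∀ s : List Bool, 0 < (s.map r).prod := fun s =>
    List.prod_pos fun x hx => by
      obtain ⟨y, _, rfl⟩ := List.mem_map.mp hx
      exact hr0 y
  have hlog : ∀ s : List Bool, -Real.log ((s.map r).prod / (n + 1)) =
      Real.log (n + 1) + (s.map fun x => -Real.log (r x)).sum := by
    intro s
    rw [Real.log_div (hprod s).ne' hn.ne']
    have : -Real.log (s.map r).prod = (s.map fun x => -Real.log (r x)).sum := by
      induction s with
      | nil => simp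
      | cons x s ih =>
        rw [List.map_cons, List.prod_cons, Real.log_mul (hr0 x).ne' (hprod s).ne', List.map_cons,
          List.sum_cons, ← ih]
        ring
    linarith
  have hsum : ∀ w : Block K n, ((refineBits C D w).map fun x => -Real.log (r x)).sum =
      ∑ t, if OnesOn C (w t) then
        (if OnesOn D (w t) then -Real.log b else -Real.log (1 - b)) else 0 := by
    intro w
    rw [Fin.sum_univ_def, refineBits, activeTimes, List.map_map]
    induction List.finRange n with
    | nil => rfl
    | cons t T ih =>
      by_cases ht : OnesOn C (w t)
      · rw [List.filter_cons_of_pos (by simpa using ht), List.map_cons, List.sum_cons, ih,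
          List.map_cons, List.sum_cons, if_pos ht]
        simp only [hr, Function.comp_apply, decide_eq_true_eq, apply_ite Real.log]
        split_ifs <;> rfl
      · rw [List.filter_cons_of_neg (by simpa using ht), ih, List.map_cons, List.sum_cons,
          if_neg ht, zero_add]
  refine (entropyBits_le_cross (blockLaw_nonneg (bernLaw_nonneg hε0.le hε1.le))
    (sum_blockLaw (sum_bernLaw ε) n) _ (fun s => (s.map r).prod / (n + 1))
    (fun s => div_pos (hprod s) hn) ?_).trans_eq ?_
  · rw [← Finset.sum_div, div_le_one hn]
    refine sum_list_prod_le (fun x => (hr0 x).le) (by simp [hr]) n _ fun s hs => ?_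
    obtain ⟨w, _, rfl⟩ := Finset.mem_image.mp hs
    rw [refineBits, List.length_map]
    exact (List.length_filter_le _ _).trans (List.length_finRange).le
  · simp only [hlog, hsum, mul_add, Finset.mul_sum]
    rw [Finset.sum_add_distrib, ← Finset.sum_mul, sum_blockLaw (sum_bernLaw ε), Finset.sum_comm]
    simp only [sum_blockLaw_mul_apply (sum_bernLaw ε) (fun v => if OnesOn C v then
        (if OnesOn D v then -Real.log b else -Real.log (1 - b)) else 0)]
    rw [sum_bernLaw_mul_codeLength ε hCD.subset, Finset.sum_const, Finset.card_univ,
      Fintype.card_fin, nsmul_eq_mul, binEntropyBits]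
    ring

/-! ### Achievable rates -/

theorem isAchievableSumRate_of_chain {N K : ℕ} {Z : Fin N → Finset (Fin K)} {ε : ℝ} (hε0 : 0 < ε)
    (hε1 : ε < 1) (C : ℕ → Finset (Fin K)) (h0 : C 0 = ∅) (hC : Monotone C) (L : ℕ)
    (server : Fin L → Fin N) (hs : Function.Injective server)
    (hZ : ∀ l : Fin L, C (l + 1) \ C l ⊆ Z (server l))
    (hcov : ∀ l : Fin L, Z (server l) ⊆ C (l + 1)) (hL : C L = Finset.univ)
    (hlt : ∀ l < L, C l ⊂ C (l + 1)) :
    IsAchievableSumRate Z (bernLaw K ε) (multilinearDemand K)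
      (∑ l ∈ Finset.range L, ε ^ (C l).card * binEntropyBits (ε ^ ((C (l + 1)).card - (C l).card))) := by
  intro δ hδ
  have hlim : Filter.Tendsto (fun n : ℕ => L * (Real.log ((n : ℝ) + 1) / Real.log 2) / n)
      Filter.atTop (nhds 0) := by
    have h1 : Filter.Tendsto (fun n : ℕ => Real.log ((n : ℝ) + 1) / ((n : ℝ) + 1))
        Filter.atTop (nhds 0) :=
      (Real.isLittleO_log_id_atTop.tendsto_div_nhds_zero).comp
        (Filter.tendsto_atTop_add_const_right _ 1 tendsto_natCast_atTop_atTop)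
    have h2 : Filter.Tendsto (fun n : ℕ => ((n : ℝ) + 1) / n) Filter.atTop (nhds 1) := by
      have := (tendsto_one_div_atTop_nhds_zero_nat (𝕜 := ℝ)).const_add 1
      rw [add_zero] at this
      refine this.congr' ?_
      filter_upwards [Filter.eventually_gt_atTop 0] with n hn
      have : (n : ℝ) ≠ 0 := by positivity
      field_simp
    have h3 := (h1.mul h2).const_mul (L / Real.log 2)
    rw [zero_mul, mul_zero] at h3
    refine h3.congr fun n => ?_
    have : (n : ℝ) + 1 ≠ 0 := by positivity
    field_simp
  obtain ⟨n₀, hn₀⟩ := Filter.eventually_atTop.mp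
    ((hlim.eventually_le_const hδ).and (Filter.eventually_gt_atTop 0))
  refine ⟨n₀, fun n hn => ?_⟩
  obtain ⟨hle, hpos⟩ := hn₀ n hn
  have hn' : (0 : ℝ) < n := by exact_mod_cast hpos
  refine ⟨chainScheme Z C h0 hC L server hs hZ n, chainScheme_isColoring _ hcov,
    chainScheme_isLossless _ hL, ?_⟩
  change ∑ l : Fin L, entropyBits (blockLaw (bernLaw K ε) n)
    (fun w => Encodable.encode (refineBits (C l) (C (l + 1)) w)) / (n : ℝ) ≤ _
  have hterm : ∀ l : Fin L, entropyBits (blockLaw (bernLaw K ε) n)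
      (fun w => Encodable.encode (refineBits (C l) (C (l + 1)) w)) / (n : ℝ) ≤
      ε ^ (C l).card * binEntropyBits (ε ^ ((C (l + 1)).card - (C l).card))
        + Real.log (n + 1) / Real.log 2 / n := by
    intro l
    rw [entropyBits_comp_injective _ _ Encodable.encode_injective, div_le_iff₀ hn']
    refine (entropyBits_refineBits_le hε0 hε1 (hlt l l.isLt) n).trans_eq ?_
    field_simp
    ring
  refine (Finset.sum_le_sum fun l _ => hterm l).trans ?_
  rw [Finset.sum_add_distrib, Finset.sum_const, Finset.card_univ, Fintype.card_fin, nsmul_eq_mul,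
    ← Fin.sum_univ_eq_sum_range
      (fun l => ε ^ (C l).card * binEntropyBits (ε ^ ((C (l + 1)).card - (C l).card))),
    ← mul_div_assoc]
  linarith

theorem SeqScheme.sumRate_nonneg {N K n : ℕ} {Z : Fin N → Finset (Fin K)} (c : SeqScheme Z n)
    {p : Data K → ℝ} (hp0 : ∀ v, 0 ≤ p v) (hp1 : ∑ v, p v = 1) : 0 ≤ c.sumRate p :=
  Finset.sum_nonneg fun _ _ => div_nonneg
    (entropyBits_nonneg (blockLaw_nonneg hp0) (sum_blockLaw hp1 n) _) n.cast_nonneg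

/-- Supplies the lower bound without which the real infimum would not be controlled by its members.
-/
theorem IsAchievableSumRate.nonneg {N K : ℕ} {Z : Fin N → Finset (Fin K)} {p : Data K → ℝ}
    {f : Data K → ZMod 2} {R : ℝ} (h : IsAchievableSumRate Z p f R) (hp0 : ∀ v, 0 ≤ p v)
    (hp1 : ∑ v, p v = 1) : 0 ≤ R := by
  refine le_of_forall_pos_le_add fun δ hδ => ?_
  obtain ⟨n₀, hn₀⟩ := h δ hδ
  obtain ⟨c, _, _, hc⟩ := hn₀ n₀ le_rfl
  exact (c.sumRate_nonneg hp0 hp1).trans hc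

/-! ### Cyclic placement and the chain of windows -/

/-- The subfunction indices whose residue modulo `N` is smaller than `a`. -/
def residueBelow (N K a : ℕ) : Finset (Fin K) :=
  Finset.univ.filter fun k => (k : ℕ) % N < a

theorem mem_residueBelow {N K a : ℕ} {k : Fin K} : k ∈ residueBelow N K a ↔ (k : ℕ) % N < a := by
  simp [residueBelow]

theorem residueBelow_mono (N K : ℕ) : Monotone (residueBelow N K) := fun _ _ hab _ hk =>
  mem_residueBelow.mpr ((mem_residueBelow.mp hk).trans_le hab)

theorem card_residueBelow (N Δ : ℕ) {a : ℕ} (ha : a ≤ N) :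
    (residueBelow N (Δ * N) a).card = Δ * a := by
  have h : residueBelow N (Δ * N) a =
      ((Finset.univ : Finset (Fin Δ)) ×ˢ (Finset.univ.filter fun i : Fin N => (i : ℕ) < a)).map
        finProdFinEquiv.toEmbedding := by
    ext k
    rw [Finset.mem_map_equiv, mem_residueBelow]
    simp [finProdFinEquiv]
  rw [h, Finset.card_map, Finset.card_product, Finset.card_univ, Fintype.card_fin,
    Fin.card_filter_val_lt, min_eq_right ha]

theorem mem_cyclicPlacement {N Nr Δ : ℕ} {i : Fin N} {k : Fin (Δ * N)} :
    k ∈ cyclicPlacement N Nr Δ (Δ * N) i ↔ ∃ j < N - Nr + 1, ((i : ℕ) + j) % N = (k : ℕ) % N := by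
  simp only [cyclicPlacement, Finset.mem_filter, Finset.mem_univ, true_and, Finset.mem_biUnion,
    Finset.mem_range, Finset.mem_image]
  constructor
  · rintro ⟨r, _, j, hj, h⟩
    exact ⟨j, hj, by rw [← h, Nat.add_mul_mod_self_right, Nat.mod_mod]⟩
  · rintro ⟨j, hj, h⟩
    exact ⟨(k : ℕ) / N, Nat.div_lt_of_lt_mul (k.isLt.trans_eq (mul_comm _ _)), j, hj,
      by rw [h, Nat.mod_add_div']⟩

theorem proposition3 (N Nr K Δ M Nstar ΔN ξ : ℕ) (ε : ℝ)
    (hNr : 1 ≤ Nr) (hNrN : Nr ≤ N) (hΔ : 1 ≤ Δ) (hK : K = Δ * N)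
    (hε0 : 0 < ε) (hε1 : ε < 1)
    (hM : M = Δ * (N - Nr + 1))
    (hNstar : Nstar = N / (N - Nr + 1))
    (hΔN : ΔN = N - Nstar * (N - Nr + 1))
    (hξ : ξ = Δ * ΔN) :
    IsAchievableSumRate (cyclicPlacement N Nr Δ K) (bernLaw K ε) (multilinearDemand K)
      ((1 - (ε ^ M) ^ Nstar) / (1 - ε ^ M) * binEntropyBits (ε ^ M)
        + (ε ^ M) ^ Nstar * (if 0 < ΔN then 1 else 0) * binEntropyBits (ε ^ ξ)) ∧
    achievableSumRate (cyclicPlacement N Nr Δ K) (bernLaw K ε) (multilinearDemand K) ≤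
      (1 - (ε ^ M) ^ Nstar) / (1 - ε ^ M) * binEntropyBits (ε ^ M)
        + (ε ^ M) ^ Nstar * (if 0 < ΔN then 1 else 0) * binEntropyBits (ε ^ ξ) := by
  suffices h : IsAchievableSumRate (cyclicPlacement N Nr Δ K) (bernLaw K ε) (multilinearDemand K)
      ((1 - (ε ^ M) ^ Nstar) / (1 - ε ^ M) * binEntropyBits (ε ^ M)
        + (ε ^ M) ^ Nstar * (if 0 < ΔN then 1 else 0) * binEntropyBits (ε ^ ξ)) from
    ⟨h, csInf_le ⟨0, fun R hR => IsAchievableSumRate.nonneg hR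
      (bernLaw_nonneg hε0.le hε1.le) (sum_bernLaw ε)⟩ h⟩
  subst hK
  have hN : 0 < N := hNr.trans hNrN
  set m := N - Nr + 1 with hm
  have hm0 : 0 < m := Nat.succ_pos _
  have hmod : ΔN < m := by
    have := Nat.mod_lt N hm0
    have := Nat.div_add_mod' N m
    rw [← hNstar] at this
    omega
  have hsplit : Nstar * m + ΔN = N := by
    have := Nat.div_mul_le_self N m
    rw [← hNstar] at this
    omega
  have hM1 : M ≠ 0 := hM ▸ (Nat.mul_pos hΔ hm0).ne'
  -- One extra server covers the `ΔN` residues left over by the full windows.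
  set L := Nstar + (if 0 < ΔN then 1 else 0) with hLdef
  have hlm : ∀ l < L, l * m < N := by
    intro l hl
    split_ifs at hLdef with h
    · have := Nat.mul_le_mul_right m (show l ≤ Nstar by omega)
      omega
    · have := Nat.mul_le_mul_right m (show l + 1 ≤ Nstar by omega)
      rw [Nat.succ_mul] at this
      omega
  have hLN : N ≤ L * m := by
    rw [hLdef]
    split_ifs with h
    · rw [Nat.succ_mul]; omega
    · rw [Nat.add_zero]; omega
  -- The cap at `N` matters for the cardinality when the last window is partial.
  set C : ℕ → Finset (Fin (Δ * N)) := fun l => residueBelow N (Δ * N) (min (l * m) N) with hCdef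
  have hcard : ∀ l, (C l).card = Δ * min (l * m) N := fun l =>
    card_residueBelow N Δ (min_le_right _ _)
  have hmono : Monotone C := fun a b hab =>
    residueBelow_mono _ _ (min_le_min_right _ (Nat.mul_le_mul_right m hab))
  have hmem : ∀ l (k : Fin (Δ * N)), k ∈ C l ↔ (k : ℕ) % N < l * m := by
    intro l k
    have := Nat.mod_lt (k : ℕ) hN
    simp [hCdef, mem_residueBelow, this]
  have hach := isAchievableSumRate_of_chain (Z := cyclicPlacement N Nr Δ (Δ * N)) hε0 hε1 C
    (by ext k; simp [hmem]) hmono L (fun l => ⟨l * m, hlm l l.isLt⟩)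
    (fun a b hab => Fin.ext (Nat.eq_of_mul_eq_mul_right hm0 (Fin.mk.inj hab)))
    (by
      intro l k hk
      rw [Finset.mem_sdiff, hmem, hmem, Nat.succ_mul] at hk
      refine mem_cyclicPlacement.mpr ⟨(k : ℕ) % N - l * m, by omega, ?_⟩
      dsimp only
      rw [Nat.add_sub_cancel' (by omega), Nat.mod_mod])
    (by
      intro l k hk
      obtain ⟨j, hj, h⟩ := mem_cyclicPlacement.mp hk
      rw [hmem, ← h, Nat.succ_mul]
      -- A window that wraps around only meets residues already covered, since reduction modulo `N`
      -- does not increase a number.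
      exact (Nat.mod_le _ _).trans_lt (Nat.add_lt_add_left hj _))
    (by
      ext k
      simpa [hmem] using (Nat.mod_lt (k : ℕ) hN).trans_le hLN)
    (by
      intro l hl
      refine (hmono l.le_succ).ssubset_of_ne fun h => ?_
      have h2 := congrArg Finset.card h
      rw [hcard, hcard] at h2
      have h3 := Nat.eq_of_mul_eq_mul_left hΔ h2
      have := hlm l hl
      rw [Nat.succ_mul] at h3
      omega)
  convert hach using 1
  have hle : ∀ l ≤ Nstar, (C l).card = M * l := by
    intro l hl
    have := Nat.mul_le_mul_right m hl
    rw [hcard, min_eq_left (by omega), hM]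
    ring
  have hgeom : ∑ l ∈ Finset.range Nstar,
      ε ^ (C l).card * binEntropyBits (ε ^ ((C (l + 1)).card - (C l).card)) =
      (1 - (ε ^ M) ^ Nstar) / (1 - ε ^ M) * binEntropyBits (ε ^ M) := by
    have hx : ε ^ M ≠ 1 := (pow_lt_one₀ hε0.le hε1 hM1).ne
    rw [← neg_div_neg_eq, neg_sub, neg_sub, ← geom_sum_eq hx, Finset.sum_mul]
    refine Finset.sum_congr rfl fun l hl => ?_
    have hl := Finset.mem_range.mp hl
    rw [hle l hl.le, hle (l + 1) hl, Nat.mul_succ, Nat.add_sub_cancel_left, pow_mul]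
  rw [hLdef]
  split_ifs with h
  · rw [Finset.sum_range_succ, hgeom, hle Nstar le_rfl, hcard, pow_mul, mul_one,
      min_eq_right (by rw [Nat.succ_mul]; omega)]
    -- The last increment is `Δ * N - Δ * (Nstar * m) = ξ`.
    congr 3
    rw [hξ, hM, mul_assoc, ← Nat.mul_sub, mul_comm m]
    congr 3
  · rw [Nat.add_zero, hgeom]
    ring
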